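/- Conventions. Let $X$ be a Noetherian scheme, $E$ a coherent $\mathcal O_X$-module and $n\ge 0$ an integer. We say that $E$ has homological dimension at most $n$, written $\operatorname{hd}_X E\le n$, if every point of $X$ has an open neighbourhood $U$ on which $E$ has a locally free resolution of length at most $n$, i.e. there is an exact sequence of $\mathcal O_U$-modules $$0\to E_n\to E_{n-1}\to\dots\to E_0\to E|_U\to 0$$ with all $E_j$ locally free of finite rank. For a scheme $T$, $T_{\mathrm{red}}\hookrightarrow T$ is the closed subscheme with structure sheaf $\mathcal O_T/\operatorname{Nil}(\mathcal O_T)$. An $\mathcal O_X$-module $E$ is flat over $T$ (with respect to $f\colon X\to T$) if for every $x\in X$ the stalk $E_x$ is flat over $\mathcal O_{T,f(x)}$. Theorem. Let $f\colon X\to T$ be a flat morphism of Noetherian schemes and let $E$ be a coherent $\mathcal O_X$-module that is flat over $T$. Put $X_{\mathrm{red}}=X\times_T T_{\mathrm{red}}$ (which need not be a reduced scheme) and let $E_{\mathrm{red}}=E\otimes_{\mathcal O_T}\mathcal O_{T_{\mathrm{red}}}$, i.e. the inverse image of $E$ under the projection $X_{\mathrm{red}}\to X$. Then for every integer $n\ge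 0$, $$\operatorname{hd}_X E\le n\quad\Longleftrightarrow\quad \operatorname{hd}_{X_{\mathrm{red}}}E_{\mathrm{red}}\le n .$$ -/

import Mathlib

open CategoryTheory AlgebraicGeometry

universe u

namespace SheafHomDim

/-- A coherent `𝒪_X`-module on a (locally) Noetherian scheme: quasi-coherent and of finite type. -/
structure IsCoherent {X : Scheme.{u}} (M : X.Modules) : Prop where
  isQuasicoherent : SheafOfModules.IsQuasicoherent.{u} M
  isFiniteType : SheafOfModules.IsFiniteType.{u} M

/-- `M` is locally free of finite rank: every point has an open neighbourhood `U` on which `M` is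
isomorphic to a finite direct sum of copies of `𝒪_U`. -/
def IsLocallyFreeOfFiniteRank {X : Scheme.{u}} (M : X.Modules) : Prop :=
  ∀ x : X, ∃ U : X.Opens, x ∈ U ∧ ∃ I : Type u, Finite I ∧
    Nonempty (M.restrict U.ι ≅
      (SheafOfModules.free (R := (U : Scheme.{u}).ringCatSheaf) I : (U : Scheme.{u}).Modules))

/-- A locally free resolution of length `≤ n` of an `𝒪_X`-module `M`: an exact sequence
`0 ⟶ E n ⟶ ⋯ ⟶ E 1 ⟶ E 0 ⟶ M ⟶ 0` of `𝒪_X`-modules in which every `E i` is locally free of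
finite rank (the sequence is continued to the left by zeros). -/
structure LocallyFreeResolution {X : Scheme.{u}} (M : X.Modules) (n : ℕ) where
  E : ℕ → X.Modules
  d (i : ℕ) : E (i + 1) ⟶ E i
  aug : E 0 ⟶ M
  locallyFree (i : ℕ) : IsLocallyFreeOfFiniteRank (E i)
  isZero (i : ℕ) (hi : n < i) : Limits.IsZero (E i)
  d_comp_d (i : ℕ) : d (i + 1) ≫ d i = 0
  d_comp_aug : d 0 ≫ aug = 0
  exact_succ (i : ℕ) : (ShortComplex.mk (d (i + 1)) (d i) (d_comp_d i)).Exact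
  exact_zero : (ShortComplex.mk (d 0) aug d_comp_aug).Exact
  epi_aug : Epi aug

/-- `hd_X M ≤ n`, for a coherent `𝒪_X`-module `M`: every point of `X` has an open neighbourhood
on which `M` has a locally free resolution of length `≤ n`. -/
def HomologicalDimensionLE {X : Scheme.{u}} (M : X.Modules) (n : ℕ) : Prop :=
  ∀ x : X, ∃ U : X.Opens, x ∈ U ∧ Nonempty (LocallyFreeResolution (M.restrict U.ι) n)

/-- The `𝒪_{X,x}`-module structure on the stalk `M_x`. -/
noncomputable instance stalkModule {X : Scheme.{u}} (M : X.Modules) (x : X) :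
    Module (X.presheaf.stalk x) ↑(TopCat.Presheaf.stalk M.presheaf x) :=
  PresheafOfModules.instModuleCarrierStalkCommRingCatCarrierAbPresheafOpensCarrier
    (R := X.presheaf) M.val x

/-- The `𝒪_X`-module `M` is flat over `T`: for every `x` in `X` the stalk `M_x` is flat as a
module over `𝒪_{T,f(x)}`, which acts through `f^♯ : 𝒪_{T,f(x)} ⟶ 𝒪_{X,x}`. -/
def IsFlatOver {X T : Scheme.{u}} (f : X ⟶ T) (M : X.Modules) : Prop :=
  ∀ x : X,
    letI : Module (T.presheaf.stalk (f x)) ↑(TopCat.Presheaf.stalk M.presheaf x) :=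
      Module.compHom _ (f.stalkMap x).hom
    Module.Flat (T.presheaf.stalk (f x)) ↑(TopCat.Presheaf.stalk M.presheaf x)

/-- The canonical closed immersion `T_red ⟶ T`, where `T_red` is the closed subscheme with
structure sheaf `𝒪_T / Nil 𝒪_T`. -/
noncomputable abbrev redι (T : Scheme.{u}) : T.nilradical.subscheme ⟶ T :=
  T.nilradical.subschemeι

/-- `X_red = X ×_T T_red` (which need not be reduced). -/
noncomputable abbrev baseRed {X T : Scheme.{u}} (f : X ⟶ T) : Scheme.{u} :=
  Limits.pullback f (redι T)

/-- `E_red = E ⊗_{𝒪_T} 𝒪_{T_red}`, the inverse image of `E` under the projection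
`X ×_T T_red ⟶ X`. -/
noncomputable abbrev moduleRed {X T : Scheme.{u}} (f : X ⟶ T) (E : X.Modules) :
    (baseRed f).Modules :=
  (Scheme.Modules.pullback (Limits.pullback.fst f (redι T))).obj E

end SheafHomDim

/-! The question is local and reduces to commutative algebra. On a suitable affine chart, `A` is the
ring of an affine open of `T`, `B` is a flat `A`-algebra, `E` is given by a finite `B`-module `M`
flat over `A`, and passing to `T_red` replaces `A` by `A' = A / Nil A`, `B` by `B' = A' ⊗ B` and `M`
by `B' ⊗ M`. Since `A` is Noetherian, `Nil A` is nilpotent.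

The algebraic core, `hasProjectiveDimensionLE_baseChange_iff`, says that `M` and `B' ⊗ M` have the
same projective dimension. Flatness over `A` keeps `0 → K → F → M → 0` exact after base change and
passes to the syzygy `K`, so dimension shifting reduces to dimension zero. There
`projective_of_projective_baseChange` lifts a splitting across the nilpotent ideal.

The dictionary with sheaves uses that `tilde` is exact and fully faithful. A resolution whose terms
are free on a chart descends to modules (`hasProjectiveDimensionLE_of_resolution`); conversely, over
a Noetherian ring, bounded projective dimension yields a resolution by finite projective modules,
hence by locally free sheaves (`nonempty_locallyFreeResolution_tilde`). As `X_red → X` is a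
homeomorphism, charts of `X` and their preimages are fine enough for both implications. -/

namespace SheafHomDim

open Limits

/-! ### Projective dimension along a surjection with nilpotent kernel -/

section Algebra

open TensorProduct

/-- Tensoring `J → B → B' → 0` with `K` is right exact, so the kernel of `K → B' ⊗ K` is the image
of `J ⊗ K`, namely `JK`. -/
lemma mem_ker_smul_of_one_tmul_eq_zero {B B' K : Type*} [CommRing B] [CommRing B'] [Algebra B B']
    [AddCommGroup K] [Module B K] (hs : Function.Surjective (algebraMap B B')) {x : K}
    (hx : (1 : B') ⊗ₜ[B] x = 0) :
    x ∈ RingHom.ker (algebraMap B B') • (⊤ : Submodule B K) := by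
  have hex : Function.Exact (RingHom.ker (algebraMap B B')).subtype (Algebra.linearMap B B') := by
    rw [LinearMap.exact_iff, Submodule.range_subtype]
    ext; simp [RingHom.mem_ker]
  have h := (rTensor_exact K hex hs ((1 : B) ⊗ₜ[B] x)).mp (by simpa using hx)
  obtain ⟨y, hy⟩ := h
  have hx' : x = TensorProduct.lid B K
      (((RingHom.ker (algebraMap B B')).subtype).rTensor K y) := by rw [hy]; simp
  rw [hx']
  clear hx' hy hx
  induction y with
  | zero => simp
  | tmul a k =>
    simpa using Submodule.smul_mem_smul a.2 Submodule.mem_top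
  | add a b ha hb => rw [map_add, map_add]; exact add_mem ha hb

/-- A retraction of `g` modulo the nilpotent ideal `J` lifts to a map that is a retraction up to an
automorphism of `K`; correcting by it splits the original sequence. Nilpotence plays the role of
Nakayama, so no finiteness is needed. -/
lemma projective_of_projective_baseChange {B B' K F M : Type*} [CommRing B] [CommRing B']
    [Algebra B B'] [AddCommGroup K] [Module B K] [AddCommGroup F] [Module B F]
    [AddCommGroup M] [Module B M] (hs : Function.Surjective (algebraMap B B'))
    (hn : IsNilpotent (RingHom.ker (algebraMap B B')))
    {g : K →ₗ[B] F} {f : F →ₗ[B] M} (hf : Function.Surjective f)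
    (hgf : Function.Exact g f) [Module.Projective B F]
    (hg' : Function.Injective (g.baseChange B')) [Module.Projective B' (B' ⊗[B] M)] :
    Module.Projective B M := by
  have hf' : Function.Surjective (f.baseChange B') := LinearMap.lTensor_surjective B' hf
  have hgf' : Function.Exact (g.baseChange B') (f.baseChange B') := lTensor_exact B' hgf hf
  obtain ⟨s, hs'⟩ := Module.projective_lifting_property (f.baseChange B') LinearMap.id hf'
  obtain ⟨-, ρ', hρ'⟩ := (hgf'.split_tfae'.out 0 1 :).mp ⟨hg', s, hs'⟩
  have hπ : Function.Surjective (TensorProduct.mk B B' K 1) := by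
    intro y
    induction y with
    | zero => exact ⟨0, by simp⟩
    | tmul b k =>
      obtain ⟨b, rfl⟩ := hs b
      exact ⟨b • k, by simp [Algebra.algebraMap_eq_smul_one, TensorProduct.smul_tmul]⟩
    | add y z hy hz =>
      obtain ⟨y, rfl⟩ := hy
      obtain ⟨z, rfl⟩ := hz
      exact ⟨y + z, map_add _ _ _⟩
  -- Lift `F → B' ⊗ F → B' ⊗ K` through the surjection `K → B' ⊗ K`, using that `F` is projective.
  obtain ⟨ρ, hρ⟩ := Module.projective_lifting_property (TensorProduct.mk B B' K 1)
    ((ρ'.restrictScalars B) ∘ₗ TensorProduct.mk B B' F 1) hπ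
  let J := RingHom.ker (algebraMap B B')
  -- The defect of `ρ` as a retraction: it vanishes modulo `J`, so its `n`-th power lands in `J ^ n
  -- K`.
  let θ : Module.End B K := 1 - ρ ∘ₗ g
  have hθ (k : K) : θ k ∈ J • (⊤ : Submodule B K) := by
    apply mem_ker_smul_of_one_tmul_eq_zero hs
    have h1 := LinearMap.congr_fun hρ (g k)
    have h2 := LinearMap.congr_fun hρ' ((1 : B') ⊗ₜ k)
    simp only [LinearMap.comp_apply, TensorProduct.mk_apply, LinearMap.restrictScalars_apply,
      LinearMap.baseChange_tmul, LinearMap.id_apply] at h1 h2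
    simp [θ, TensorProduct.tmul_sub, h1, h2]
  have hθn (n : ℕ) : LinearMap.range (θ ^ n) ≤ J ^ n • (⊤ : Submodule B K) := by
    induction n with
    | zero => simp
    | succ n ih =>
      rintro _ ⟨k, rfl⟩
      have h1 : (θ ^ (n + 1)) k = θ ((θ ^ n) k) := by rw [pow_succ']; rfl
      have h2 : θ ((θ ^ n) k) ∈ Submodule.map θ (J ^ n • (⊤ : Submodule B K)) :=
        Submodule.mem_map_of_mem (ih ⟨k, rfl⟩)
      rw [h1, pow_succ, Submodule.mul_smul]
      rw [Submodule.map_smul''] at h2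
      refine Submodule.smul_mono le_rfl ?_ h2
      rintro _ ⟨k, -, rfl⟩
      exact hθ k
  have hθ0 : IsNilpotent θ := by
    obtain ⟨n, hn⟩ := hn
    refine ⟨n, LinearMap.ext fun k ↦ ?_⟩
    have := hθn n ⟨k, rfl⟩
    rw [hn] at this
    simpa using this
  have hu : IsUnit (1 - θ) := hθ0.isUnit_one_sub
  rw [show 1 - θ = ρ ∘ₗ g by simp [θ]] at hu
  obtain ⟨v, hv⟩ := hu.exists_left_inv
  obtain ⟨-, t, ht⟩ := (hgf.split_tfae'.out 1 0 :).mp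
    ⟨hf, v ∘ₗ ρ, by rw [LinearMap.comp_assoc]; exact hv⟩
  exact Module.Projective.of_split t f ht

section Flat

variable {A K F M : Type*} [CommRing A] [AddCommGroup K] [Module A K] [AddCommGroup F] [Module A F]
  [AddCommGroup M] [Module A M]

/-- The map `I ⊗ K → A ⊗ K → A ⊗ F` is also `I ⊗ K → I ⊗ F → A ⊗ F`. The first arrow of the latter
is injective because `M` is flat, the second because `F` is. -/
lemma flat_of_exact {g : K →ₗ[A] F} {f : F →ₗ[A] M} (hg : Function.Injective g)
    (hf : Function.Surjective f) (hgf : Function.Exact g f) [Module.Flat A F] [Module.Flat A M] :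
    Module.Flat A K := by
  rw [Module.Flat.iff_rTensor_injective]
  intro I _
  have h1 : Function.Injective (g.lTensor A ∘ₗ I.subtype.rTensor K) := by
    have : g.lTensor A ∘ₗ I.subtype.rTensor K = I.subtype.rTensor F ∘ₗ g.lTensor I := by
      ext; simp
    rw [this]
    exact (Module.Flat.rTensor_preserves_injective_linearMap _ I.injective_subtype).comp
      (LinearMap.lTensor_injective_of_exact_of_flat f hf g hg hgf I)
  exact Function.Injective.of_comp h1

end Flat

/-- Since `B' ⊗[B] K` is `A' ⊗[A] K`, the obstruction is `Tor₁` over `A` of `A'` and `M`, which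
vanishes by flatness of `M`. -/
lemma baseChange_injective_of_flat {A A' B B' K F M : Type*} [CommRing A] [CommRing A']
    [CommRing B] [CommRing B'] [Algebra A A'] [Algebra A B] [Algebra A B'] [Algebra A' B']
    [Algebra B B'] [IsScalarTower A A' B'] [IsScalarTower A B B'] [Algebra.IsPushout A A' B B']
    [AddCommGroup K] [Module B K] [AddCommGroup F] [Module B F] [AddCommGroup M] [Module B M]
    [Module A K] [IsScalarTower A B K] [Module A F] [IsScalarTower A B F]
    [Module A M] [IsScalarTower A B M]
    {g : K →ₗ[B] F} {f : F →ₗ[B] M} (hg : Function.Injective g) (hf : Function.Surjective f)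
    (hgf : Function.Exact g f) [Module.Flat A M] :
    Function.Injective (g.baseChange B') := by
  have h := LinearMap.lTensor_injective_of_exact_of_flat (f.restrictScalars A) hf
    (g.restrictScalars A) hg hgf A'
  let eK := Algebra.IsPushout.cancelBaseChange A A' B B' K
  let eF := Algebra.IsPushout.cancelBaseChange A A' B B' F
  have comm (x : A' ⊗[A] K) :
      eF.symm ((g.restrictScalars A).lTensor A' x) = g.baseChange B' (eK.symm x) := by
    induction x with
    | zero => simp
    | tmul a k => simp [eK, eF]
    | add x y hx hy => simp only [map_add, hx, hy]
  intro x y hxy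
  rw [← eK.symm_apply_apply x, ← eK.symm_apply_apply y, ← comm, ← comm] at hxy
  exact eK.injective (h (eF.symm.injective hxy))

lemma hasProjectiveDimensionLE_succ_iff {B K F M : Type u} [CommRing B]
    [AddCommGroup K] [Module B K] [AddCommGroup F] [Module B F] [AddCommGroup M] [Module B M]
    {g : K →ₗ[B] F} {f : F →ₗ[B] M} (hg : Function.Injective g) (hf : Function.Surjective f)
    (hgf : Function.Exact g f) [Module.Projective B F] (n : ℕ) :
    HasProjectiveDimensionLE (ModuleCat.of B M) (n + 1) ↔
      HasProjectiveDimensionLE (ModuleCat.of B K) n := by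
  have hS : (ShortComplex.mk (ModuleCat.ofHom g) (ModuleCat.ofHom f)
      (by ext x; exact hgf.apply_apply_eq_zero x)).ShortExact :=
    { exact := (ShortComplex.ShortExact.moduleCat_exact_iff_function_exact _).mpr hgf
      mono_f := (ModuleCat.mono_iff_injective _).mpr hg
      epi_g := (ModuleCat.epi_iff_surjective _).mpr hf }
  exact hS.hasProjectiveDimensionLT_X₃_iff n ((IsProjective.iff_projective F).mp inferInstance)

lemma hasProjectiveDimensionLE_zero_iff {B M : Type u} [CommRing B]
    [AddCommGroup M] [Module B M] :
    HasProjectiveDimensionLE (ModuleCat.of B M) 0 ↔ Module.Projective B M := by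
  rw [IsProjective.iff_projective]
  exact (projective_iff_hasProjectiveDimensionLE_zero (ModuleCat.of B M)).symm

lemma exists_projective_presentation (B M : Type u) [CommRing B] [AddCommGroup M] [Module B M] :
    ∃ (K F : Type u) (_ : AddCommGroup K) (_ : Module B K) (_ : AddCommGroup F) (_ : Module B F)
      (g : K →ₗ[B] F) (f : F →ₗ[B] M), Module.Projective B F ∧ Function.Injective g ∧
        Function.Surjective f ∧ Function.Exact g f :=
  let f : (M →₀ B) →ₗ[B] M := Finsupp.linearCombination B id
  ⟨LinearMap.ker f, M →₀ B, inferInstance, inferInstance, inferInstance, inferInstance,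
    (LinearMap.ker f).subtype, f, inferInstance, (LinearMap.ker f).injective_subtype,
    Finsupp.linearCombination_id_surjective B M, LinearMap.exact_subtype_ker_map f⟩

/-- Let `A → A'` be surjective with nilpotent kernel, `B` a flat `A`-algebra and `B' = A' ⊗ B`.
The projective dimension of an `A`-flat `B`-module does not change under base change to `B'`. -/
theorem hasProjectiveDimensionLE_baseChange_iff {A A' B B' : Type u} [CommRing A] [CommRing A']
    [CommRing B] [CommRing B'] [Algebra A A'] [Algebra A B] [Algebra A B'] [Algebra A' B']
    [Algebra B B'] [IsScalarTower A A' B'] [IsScalarTower A B B'] [Algebra.IsPushout A A' B B']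
    [Module.Flat A B] (hs : Function.Surjective (algebraMap A A'))
    (hn : IsNilpotent (RingHom.ker (algebraMap A A')))
    (M : Type u) [AddCommGroup M] [Module B M] [Module A M] [IsScalarTower A B M]
    [Module.Flat A M] (n : ℕ) :
    HasProjectiveDimensionLE (ModuleCat.of B' (B' ⊗[B] M)) n ↔
      HasProjectiveDimensionLE (ModuleCat.of B M) n := by
  have hs' : Function.Surjective (algebraMap B B') := by
    intro b
    induction b using (Algebra.IsPushout.out (R := A) (S := A') (R' := B) (S' := B')).inductionOn with
    | zero => exact ⟨0, map_zero _⟩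
    | tmul b => exact ⟨b, rfl⟩
    | smul s x hx =>
      obtain ⟨a, rfl⟩ := hs s
      obtain ⟨b, rfl⟩ := hx
      exact ⟨a • b, by simp [Algebra.smul_def, ← IsScalarTower.algebraMap_apply]⟩
    | add x y hx hy =>
      obtain ⟨x, rfl⟩ := hx
      obtain ⟨y, rfl⟩ := hy
      exact ⟨x + y, map_add _ _ _⟩
  have hn' : IsNilpotent (RingHom.ker (algebraMap B B')) := by
    obtain ⟨k, hk⟩ := hn
    -- As `B' = A' ⊗ B`, the kernel of `B → B'` is contained in the extension of the kernel of `A →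
    -- A'`, so it inherits its nilpotence.
    have hle : RingHom.ker (algebraMap B B') ≤
        (RingHom.ker (algebraMap A A')).map (algebraMap A B) := by
      intro b hb
      have h1 : (1 : A') ⊗ₜ[A] b = 0 := by
        rw [← Algebra.IsPushout.cancelBaseChange_tmul A A' B B' B b, ← mul_one b, ← smul_eq_mul,
          ← TensorProduct.smul_tmul, ← Algebra.algebraMap_eq_smul_one, RingHom.mem_ker.mp hb]
        simp
      have h2 := mem_ker_smul_of_one_tmul_eq_zero hs h1
      rwa [Ideal.smul_top_eq_map] at h2
    refine ⟨k, ?_⟩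
    rw [Ideal.zero_eq_bot, eq_bot_iff]
    refine (Ideal.pow_right_mono hle k).trans ?_
    rw [← Ideal.map_pow, hk]
    simp
  induction n generalizing M with
  | zero =>
    rw [hasProjectiveDimensionLE_zero_iff, hasProjectiveDimensionLE_zero_iff]
    refine ⟨fun _ ↦ ?_, fun _ ↦ inferInstance⟩
    obtain ⟨K, F, _, _, _, _, g, f, _, hg, hf, hgf⟩ := exists_projective_presentation B M
    let _ : Module A K := Module.compHom K (algebraMap A B)
    let _ : Module A F := Module.compHom F (algebraMap A B)
    have : IsScalarTower A B K := .of_compHom A B K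
    have : IsScalarTower A B F := .of_compHom A B F
    exact projective_of_projective_baseChange hs' hn' hf hgf
      (baseChange_injective_of_flat (A := A) (A' := A') hg hf hgf)
  | succ n ih =>
    obtain ⟨K, F, _, _, _, _, g, f, _, hg, hf, hgf⟩ := exists_projective_presentation B M
    let _ : Module A K := Module.compHom K (algebraMap A B)
    let _ : Module A F := Module.compHom F (algebraMap A B)
    have : IsScalarTower A B K := .of_compHom A B K
    have : IsScalarTower A B F := .of_compHom A B F
    -- `F` is projective over `B` and `B` is flat over `A`; hence the syzygy `K` is again `A`-flat
    -- and the induction hypothesis applies to it.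
    have : Module.Flat A F := .trans A B _
    have : Module.Flat A K :=
      flat_of_exact (g := g.restrictScalars A) (f := f.restrictScalars A) hg hf hgf
    refine Iff.trans ?_ ((ih K).trans (hasProjectiveDimensionLE_succ_iff hg hf hgf n).symm)
    exact hasProjectiveDimensionLE_succ_iff (g := g.baseChange B') (f := f.baseChange B')
      (baseChange_injective_of_flat (A := A) (A' := A') hg hf hgf)
      (LinearMap.lTensor_surjective B' hf) (lTensor_exact B' hgf hf) n

end Algebra

/-! ### Exactness of restriction and of `tilde` -/

section Exactness

lemma mono_iff_injective_app {X : Scheme.{u}} {M N : X.Modules} (φ : M ⟶ N) :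
    Mono φ ↔ ∀ U : X.Opens, Function.Injective (φ.app U) := by
  rw [← (Scheme.Modules.toPresheaf X).mono_map_iff_mono, NatTrans.mono_iff_mono_app,
    Opposite.op_surjective.forall]
  exact forall_congr' fun U ↦ AddCommGrpCat.mono_iff_injective _

instance restrictFunctor_preservesMonomorphisms {X Y : Scheme.{u}} (f : X ⟶ Y)
    [IsOpenImmersion f] : (Scheme.Modules.restrictFunctor f).PreservesMonomorphisms where
  preserves φ hφ := by
    rw [mono_iff_injective_app] at hφ ⊢
    exact fun U ↦ hφ _

instance restrictFunctor_additive {X Y : Scheme.{u}} (f : X ⟶ Y) [IsOpenImmersion f] :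
    (Scheme.Modules.restrictFunctor f).Additive where
  map_add := rfl

instance restrictFunctor_preservesHomology {X Y : Scheme.{u}} (f : X ⟶ Y) [IsOpenImmersion f] :
    (Scheme.Modules.restrictFunctor f).PreservesHomology :=
  Functor.preservesHomology_of_preservesMonos_and_cokernels _

/-- Sections of `tilde M` are families of elements of the localizations of `M`, and localization
preserves injectivity. -/
instance tilde_preservesMonomorphisms {R : CommRingCat.{u}} :
    (tilde.functor R).PreservesMonomorphisms where
  preserves {M N} φ hφ := by
    rw [ModuleCat.mono_iff_injective] at hφ
    rw [mono_iff_injective_app]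
    intro U s t hst
    refine Subtype.ext (funext fun p ↦ ?_)
    have h := congrFun (congrArg Subtype.val hst) p
    let q : PrimeSpectrum R := p.1
    have h' := IsLocalizedModule.map_injective q.asIdeal.primeCompl
      (LocalizedModule.mkLinearMap q.asIdeal.primeCompl M)
      (LocalizedModule.mkLinearMap q.asIdeal.primeCompl N) φ.hom hφ
    exact h' h

instance tilde_preservesHomology {R : CommRingCat.{u}} :
    (tilde.functor R).PreservesHomology :=
  Functor.preservesHomology_of_preservesMonos_and_cokernels _

end Exactness

/-! ### Pullback of `tilde` is extension of scalars -/

section Pullback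

/-- Pushforward along `Spec S ⟶ Spec R` is restriction of scalars on global sections. -/
noncomputable def pushforwardCompΓ {R S : CommRingCat.{u}} (φ : R ⟶ S) :
    Scheme.Modules.pushforward (Spec.map φ) ⋙ moduleSpecΓFunctor (R := R) ≅
      moduleSpecΓFunctor (R := S) ⋙ ModuleCat.restrictScalars φ.hom :=
  Functor.isoWhiskerRight (pushforwardCompModulesSpecToSheafIso φ)
    (TopCat.Sheaf.forget _ _ ⋙ (evaluation _ _).obj (.op ⊤))

/-- The pullback of the module associated with `M` along `Spec S ⟶ Spec R` is the module associated
with `S ⊗[R] M`. -/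
noncomputable def tildeCompPullback {R S : CommRingCat.{u}} (φ : R ⟶ S) :
    tilde.functor R ⋙ Scheme.Modules.pullback (Spec.map φ) ≅
      ModuleCat.extendScalars φ.hom ⋙ tilde.functor S :=
  -- Uniqueness of left adjoints: the right adjoints of the two composites are identified by
  -- `pushforwardCompΓ`.
  ((conjugateIsoEquiv
    ((tilde.adjunction (R := R)).comp (Scheme.Modules.pullbackPushforwardAdjunction (Spec.map φ)))
    ((ModuleCat.extendRestrictScalarsAdj φ.hom).comp (tilde.adjunction (R := S)))).symm
    (pushforwardCompΓ φ)).symm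

end Pullback

/-! ### Free and locally free modules -/

section LocallyFree

/-- The free `𝒪_X`-module on a type `I`. -/
noncomputable abbrev freeModule (X : Scheme.{u}) (I : Type u) : X.Modules :=
  SheafOfModules.free (R := X.ringCatSheaf) I

/-- The restriction of a free module is free. -/
noncomputable def restrictFreeIso {X Y : Scheme.{u}} (f : X ⟶ Y) [IsOpenImmersion f] (I : Type u) :
    (freeModule Y I).restrict f ≅ freeModule X I :=
  letI F : SheafOfModules.{u} Y.ringCatSheaf ⥤ SheafOfModules.{u} X.ringCatSheaf :=
    Scheme.Modules.restrictFunctor f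
  haveI : PreservesColimitsOfShape (Discrete I) F :=
    (inferInstance : PreservesColimitsOfShape (Discrete I) (Scheme.Modules.restrictFunctor f))
  (SheafOfModules.mapFreeIso F I (Scheme.Modules.restrictUnitIso f).symm).symm

/-- Restriction along a composite of open immersions, in steps. -/
noncomputable def restrictLiftIso {X Y Z : Scheme.{u}} (M : X.Modules) (j : Y ⟶ X) (k : Z ⟶ X)
    [IsOpenImmersion j] [IsOpenImmersion k] (i : Z ⟶ Y) [IsOpenImmersion i] (h : i ≫ j = k) :
    M.restrict k ≅ (M.restrict j).restrict i :=
  (Scheme.Modules.restrictFunctorCongr h.symm).app M ≪≫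
    (Scheme.Modules.restrictFunctorComp i j).app M

lemma IsLocallyFreeOfFiniteRank.of_openImmersion {X : Scheme.{u}} {M : X.Modules}
    (h : ∀ x : X, ∃ (Y : Scheme.{u}) (j : Y ⟶ X) (_ : IsOpenImmersion j) (I : Type u),
      x ∈ Set.range j ∧ Finite I ∧ Nonempty (M.restrict j ≅ freeModule Y I)) :
    IsLocallyFreeOfFiniteRank M := by
  intro x
  obtain ⟨Y, j, _, I, hx, hI, ⟨e⟩⟩ := h x
  refine ⟨j.opensRange, hx, I, hI, ⟨?_⟩⟩
  let i : (j.opensRange : Scheme.{u}) ⟶ Y := IsOpenImmersion.lift j j.opensRange.ι (by simp)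
  have hi : i ≫ j = j.opensRange.ι := IsOpenImmersion.lift_fac _ _ _
  have : IsOpenImmersion i := by
    have : IsOpenImmersion (i ≫ j) := by rw [hi]; infer_instance
    exact IsOpenImmersion.of_comp i j
  exact restrictLiftIso M j j.opensRange.ι i hi ≪≫
    (Scheme.Modules.restrictFunctor i).mapIso e ≪≫ restrictFreeIso i I

lemma IsLocallyFreeOfFiniteRank.of_iso {X : Scheme.{u}} {M N : X.Modules} (e : M ≅ N)
    (h : IsLocallyFreeOfFiniteRank M) : IsLocallyFreeOfFiniteRank N := by
  intro x
  obtain ⟨U, hx, I, hI, ⟨e'⟩⟩ := h x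
  exact ⟨U, hx, I, hI, ⟨(Scheme.Modules.restrictFunctor U.ι).mapIso e.symm ≪≫ e'⟩⟩

lemma IsLocallyFreeOfFiniteRank.restrict {X Y : Scheme.{u}} {M : X.Modules}
    (h : IsLocallyFreeOfFiniteRank M) (f : Y ⟶ X) [IsOpenImmersion f] :
    IsLocallyFreeOfFiniteRank (M.restrict f) := by
  intro y
  obtain ⟨U, hx, I, hI, ⟨e⟩⟩ := h (f y)
  refine ⟨f ⁻¹ᵁ U, hx, I, hI, ⟨?_⟩⟩
  exact ((Scheme.Modules.restrictFunctorComp (f ⁻¹ᵁ U).ι f).app M).symm ≪≫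
    restrictLiftIso M U.ι ((f ⁻¹ᵁ U).ι ≫ f) (f ∣_ U) (morphismRestrict_ι f U) ≪≫
    (Scheme.Modules.restrictFunctor (f ∣_ U)).mapIso e ≪≫ restrictFreeIso _ I

lemma isLocallyFreeOfFiniteRank_free {X : Scheme.{u}} (I : Type u) [Finite I] :
    IsLocallyFreeOfFiniteRank (freeModule X I) :=
  fun _ ↦ ⟨⊤, trivial, I, inferInstance, ⟨restrictFreeIso _ I⟩⟩

lemma isZero_freeModule (X : Scheme.{u}) (I : Type u) [IsEmpty I] : IsZero (freeModule X I) := by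
  rw [IsZero.iff_id_eq_zero]
  exact (SheafOfModules.freeHomEquiv (R := X.ringCatSheaf) _).injective (Subsingleton.elim _ _)

lemma isLocallyFreeOfFiniteRank_of_isZero {X : Scheme.{u}} {M : X.Modules} (h : IsZero M) :
    IsLocallyFreeOfFiniteRank M :=
  (isLocallyFreeOfFiniteRank_free PEmpty).of_iso ((isZero_freeModule X PEmpty).iso h)

lemma nonempty_extendScalars_iso {R S : Type u} [CommRing R] [CommRing S] (f : R →+* S)
    [inst : Algebra R S] (h : algebraMap R S = f) (P : ModuleCat.{u} R) :
    Nonempty ((ModuleCat.extendScalars f).obj P ≅ ModuleCat.of S (TensorProduct R S P)) := by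
  obtain rfl : inst = f.toAlgebra := Algebra.algebra_ext _ _ fun r ↦ congr($h r)
  exact ⟨Iso.refl _⟩

/-- A finite projective module is free over the local ring at each prime, and finite presentation
spreads this freeness to a basic open `D(r)`. -/
lemma isLocallyFreeOfFiniteRank_tilde {R : CommRingCat.{u}} (P : ModuleCat.{u} R)
    [Module.Finite R P] [Module.Projective R P] : IsLocallyFreeOfFiniteRank (tilde P) := by
  have : Module.FinitePresentation R P := Module.finitePresentation_of_projective R P
  refine .of_openImmersion fun (x : PrimeSpectrum R) ↦ ?_
  have : Module.Free (Localization.AtPrime x.asIdeal)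
    (LocalizedModule x.asIdeal.primeCompl P) := Module.free_of_flat_of_isLocalRing
  obtain ⟨r, hr, _, _⟩ := Module.FinitePresentation.exists_free_localizedModule_powers
    x.asIdeal.primeCompl (LocalizedModule.mkLinearMap x.asIdeal.primeCompl P)
    (Localization.AtPrime x.asIdeal)
  let φ : R ⟶ CommRingCat.of (Localization.Away r) :=
    CommRingCat.ofHom (algebraMap R (Localization.Away r))
  have hx : x ∈ Set.range (Spec.map φ) := by
    have h := PrimeSpectrum.localization_away_comap_range (Localization.Away r) r
    have hx : x ∈ (PrimeSpectrum.basicOpen r : Set (PrimeSpectrum R)) := hr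
    rw [← h] at hx
    exact hx
  let Q : ModuleCat (Localization.Away r) := ModuleCat.of _ (LocalizedModule.Away r P)
  obtain ⟨e₀⟩ := nonempty_extendScalars_iso (algebraMap R (Localization.Away r)) rfl P
  let e : (ModuleCat.extendScalars φ.hom).obj P ≅ Q :=
    e₀ ≪≫ ((isLocalizedModule_iff_isBaseChange (.powers r) (Localization.Away r)
      (LocalizedModule.mkLinearMap (.powers r) P)).mp inferInstance).equiv.toModuleIso
  have : Module.Finite (Localization.Away r) (LocalizedModule.Away r P) := inferInstance
  let I := Module.Free.ChooseBasisIndex (Localization.Away r) (LocalizedModule.Away r P)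
  let e' : Q ≅ ModuleCat.of _ (I →₀ Localization.Away r) :=
    (Module.Free.chooseBasis (Localization.Away r) (LocalizedModule.Away r P)).repr.toModuleIso
  refine ⟨_, Spec.map φ, inferInstanceAs (IsOpenImmersion (Spec.map (CommRingCat.ofHom
    (algebraMap R (Localization.Away r))))), I, hx, inferInstance, ⟨?_⟩⟩
  exact (Scheme.Modules.restrictFunctorIsoPullback (Spec.map φ)).app (tilde P) ≪≫
    (tildeCompPullback φ).app P ≪≫ (tilde.functor _).mapIso (e ≪≫ e') ≪≫ tildeFinsupp I

end LocallyFree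

/-! ### Operations on locally free resolutions -/

namespace LocallyFreeResolution

variable {X Y : Scheme.{u}} {M N : X.Modules} {n : ℕ}

/-- Transport of a locally free resolution along an isomorphism. -/
noncomputable def ofIso (r : LocallyFreeResolution M n) (e : M ≅ N) :
    LocallyFreeResolution N n where
  E := r.E
  d := r.d
  aug := r.aug ≫ e.hom
  locallyFree := r.locallyFree
  isZero := r.isZero
  d_comp_d := r.d_comp_d
  d_comp_aug := by rw [← Category.assoc, r.d_comp_aug, zero_comp]
  exact_succ := r.exact_succ
  exact_zero := by
    let φ : ShortComplex.mk (r.d 0) r.aug r.d_comp_aug ⟶ ShortComplex.mk (r.d 0) (r.aug ≫ e.hom)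
        (by rw [← Category.assoc, r.d_comp_aug, zero_comp]) :=
      { τ₁ := 𝟙 _, τ₂ := 𝟙 _, τ₃ := e.hom }
    exact (ShortComplex.exact_iff_of_epi_of_isIso_of_mono φ).mp r.exact_zero
  epi_aug := have := r.epi_aug; epi_comp _ _

/-- Restriction of a locally free resolution along an open immersion. -/
noncomputable def restrict (r : LocallyFreeResolution M n) (f : Y ⟶ X) [IsOpenImmersion f] :
    LocallyFreeResolution (M.restrict f) n where
  E i := (r.E i).restrict f
  d i := (Scheme.Modules.restrictFunctor f).map (r.d i)
  aug := (Scheme.Modules.restrictFunctor f).map r.aug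
  locallyFree i := (r.locallyFree i).restrict f
  isZero i hi := Functor.map_isZero _ (r.isZero i hi)
  d_comp_d i := by rw [← Functor.map_comp, r.d_comp_d, Functor.map_zero]
  d_comp_aug := by rw [← Functor.map_comp, r.d_comp_aug, Functor.map_zero]
  exact_succ i := (r.exact_succ i).map (Scheme.Modules.restrictFunctor f)
  exact_zero := r.exact_zero.map (Scheme.Modules.restrictFunctor f)
  epi_aug := have := r.epi_aug; inferInstance

/-- A locally free module is its own resolution. -/
noncomputable def self (h : IsLocallyFreeOfFiniteRank M) : LocallyFreeResolution M 0 where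
  E | 0 => M
    | _ + 1 => freeModule X PEmpty
  d _ := 0
  aug := 𝟙 M
  locallyFree
    | 0 => h
    | _ + 1 => isLocallyFreeOfFiniteRank_of_isZero (isZero_freeModule X PEmpty)
  isZero
    | 0, hi => absurd hi (lt_irrefl 0)
    | _ + 1, _ => isZero_freeModule X PEmpty
  d_comp_d _ := comp_zero
  d_comp_aug := zero_comp
  exact_succ _ := ShortComplex.exact_of_isZero_X₂ _ (isZero_freeModule X PEmpty)
  exact_zero := (ShortComplex.exact_iff_mono _ rfl).mpr (inferInstanceAs (Mono (𝟙 M)))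
  epi_aug := inferInstanceAs (Epi (𝟙 M))

/-- Splicing a short exact sequence with locally free middle term and a resolution of its kernel. -/
noncomputable def cons {S : ShortComplex X.Modules} (hS : S.ShortExact)
    (h : IsLocallyFreeOfFiniteRank S.X₂) (r : LocallyFreeResolution S.X₁ n) :
    LocallyFreeResolution S.X₃ (n + 1) where
  E | 0 => S.X₂
    | i + 1 => r.E i
  d | 0 => r.aug ≫ S.f
    | i + 1 => r.d i
  aug := S.g
  locallyFree
    | 0 => h
    | i + 1 => r.locallyFree i
  isZero
    | 0, hi => absurd hi (Nat.not_lt_zero _)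
    | i + 1, hi => r.isZero i (Nat.lt_of_succ_lt_succ hi)
  d_comp_d
    | 0 => by rw [← Category.assoc, r.d_comp_aug, zero_comp]
    | i + 1 => r.d_comp_d i
  d_comp_aug := by rw [Category.assoc, S.zero, comp_zero]
  exact_succ
    | 0 => by
      have := hS.mono_f
      let φ : ShortComplex.mk (r.d 0) r.aug r.d_comp_aug ⟶
          ShortComplex.mk (r.d 0) (r.aug ≫ S.f) (by rw [← Category.assoc, r.d_comp_aug, zero_comp]) :=
        { τ₁ := 𝟙 _, τ₂ := 𝟙 _, τ₃ := S.f }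
      exact (ShortComplex.exact_iff_of_epi_of_isIso_of_mono φ).mp r.exact_zero
    | i + 1 => r.exact_succ i
  exact_zero := by
    have := r.epi_aug
    let φ : ShortComplex.mk (r.aug ≫ S.f) S.g (by rw [Category.assoc, S.zero, comp_zero]) ⟶ S :=
      { τ₁ := r.aug, τ₂ := 𝟙 _, τ₃ := 𝟙 _ }
    exact (ShortComplex.exact_iff_of_epi_of_isIso_of_mono φ).mpr hS.exact
  epi_aug := hS.epi_g

/-- The resolution of the first syzygy obtained by truncating a locally free resolution. -/
noncomputable def tail (r : LocallyFreeResolution M (n + 1)) :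
    LocallyFreeResolution (kernel r.aug) n where
  E i := r.E (i + 1)
  d i := r.d (i + 1)
  aug := kernel.lift r.aug (r.d 0) r.d_comp_aug
  locallyFree i := r.locallyFree (i + 1)
  isZero i hi := r.isZero (i + 1) (Nat.succ_lt_succ hi)
  d_comp_d i := r.d_comp_d (i + 1)
  d_comp_aug := by rw [← cancel_mono (kernel.ι r.aug)]; simp [r.d_comp_d]
  exact_succ i := r.exact_succ (i + 1)
  exact_zero := by
    let φ : ShortComplex.mk (r.d 1) (kernel.lift r.aug (r.d 0) r.d_comp_aug)
          (by rw [← cancel_mono (kernel.ι r.aug)]; simp [r.d_comp_d]) ⟶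
        ShortComplex.mk (r.d 1) (r.d 0) (r.d_comp_d 0) :=
      { τ₁ := 𝟙 _, τ₂ := 𝟙 _, τ₃ := kernel.ι r.aug }
    exact (ShortComplex.exact_iff_of_epi_of_isIso_of_mono φ).mpr (r.exact_succ 0)
  epi_aug := r.exact_zero.epi_kernelLift

end LocallyFreeResolution

/-! ### Resolutions on an affine scheme and projective dimension -/

section Affine

variable {R : CommRingCat.{u}}

/-- Terms that are free on all of `Spec R` come from free modules. Full faithfulness turns the
augmentation into a module map and exactness identifies its kernel, so one peels off a term at a
time. -/
lemma hasProjectiveDimensionLE_of_resolution {n : ℕ} {N : (Spec R).Modules}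
    (r : LocallyFreeResolution N n)
    (hr : ∀ i, ∃ I : Type u, Finite I ∧ Nonempty (r.E i ≅ freeModule (Spec R) I))
    (M : ModuleCat.{u} R) (e : N ≅ (tilde.functor R).obj M) : HasProjectiveDimensionLE M n := by
  induction n generalizing N M with
  | zero =>
    obtain ⟨I, hI, ⟨e₀⟩⟩ := hr 0
    have := r.epi_aug
    -- In length zero the term `E 1` vanishes, so the augmentation is an isomorphism.
    have : Mono r.aug := (ShortComplex.exact_iff_mono _
      ((r.isZero 1 zero_lt_one).eq_of_src _ _)).mp r.exact_zero
    have : IsIso r.aug := isIso_of_mono_of_epi _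
    let e₁ : ModuleCat.of R (I →₀ R) ≅ M := (tilde.functor R).preimageIso
      (tildeFinsupp I ≪≫ e₀.symm ≪≫ asIso r.aug ≪≫ e)
    have : HasProjectiveDimensionLE (ModuleCat.of R (I →₀ R)) 0 :=
      hasProjectiveDimensionLE_zero_iff.mpr inferInstance
    exact hasProjectiveDimensionLT_of_iso e₁ 1
  | succ n ih =>
    obtain ⟨I, hI, ⟨e₀⟩⟩ := hr 0
    have := r.epi_aug
    let e₁ : (tilde.functor R).obj (ModuleCat.of R (I →₀ R)) ≅ r.E 0 := tildeFinsupp I ≪≫ e₀.symm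
    let f : ModuleCat.of R (I →₀ R) ⟶ M :=
      (tilde.functor R).preimage (e₁.hom ≫ r.aug ≫ e.hom)
    have hf : (tilde.functor R).map f = e₁.hom ≫ r.aug ≫ e.hom := (tilde.functor R).map_preimage _
    have : Epi ((tilde.functor R).map f) := by rw [hf]; infer_instance
    have : Epi f := (tilde.functor R).epi_of_epi_map this
    have hS : (ShortComplex.mk (kernel.ι f) f (kernel.condition f)).ShortExact :=
      { exact := ShortComplex.exact_kernel f }
    have hproj : Projective (ModuleCat.of R (I →₀ R)) :=
      (IsProjective.iff_projective (I →₀ R)).mp inferInstance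
    refine (hS.hasProjectiveDimensionLT_X₃_iff n hproj).mpr ?_
    refine ih r.tail (fun i ↦ hr (i + 1)) (kernel f) ?_
    have := (tilde.functor R).preservesFiniteLimits_of_preservesHomology
    exact (PreservesKernel.iso (tilde.functor R) f ≪≫
      kernel.mapIso _ _ e₁ e.symm (by rw [hf]; simp)).symm

/-- Over a Noetherian ring the kernel of a finite free cover is finite. Its projective dimension
drops by one, and the last syzygy is finite projective. -/
lemma nonempty_locallyFreeResolution_tilde [IsNoetherianRing R] (n : ℕ) (M : ModuleCat.{u} R)
    [Module.Finite R M] (h : HasProjectiveDimensionLE M n) :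
    Nonempty (LocallyFreeResolution (tilde M) n) := by
  induction n generalizing M with
  | zero =>
    have : Module.Projective R M := hasProjectiveDimensionLE_zero_iff.mp h
    exact ⟨.self (isLocallyFreeOfFiniteRank_tilde M)⟩
  | succ n ih =>
    obtain ⟨k, f, hf⟩ := Module.Finite.exists_fin' R M
    let F : ModuleCat.{u} R := ModuleCat.of R (ULift.{u} (Fin k) →₀ R)
    let f' : F ⟶ M := ModuleCat.ofHom (f ∘ₗ
      ((Finsupp.domLCongr Equiv.ulift).trans (Finsupp.linearEquivFunOnFinite R R (Fin k))).toLinearMap)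
    have : Epi f' := by
      rw [ModuleCat.epi_iff_surjective]
      exact hf.comp (LinearEquiv.surjective _)
    have hS : (ShortComplex.mk (kernel.ι f') f' (kernel.condition f')).ShortExact :=
      { exact := ShortComplex.exact_kernel f' }
    have hproj : Projective F := (IsProjective.iff_projective _).mp inferInstance
    have hK : HasProjectiveDimensionLE (kernel f') n :=
      (hS.hasProjectiveDimensionLT_X₃_iff n hproj).mp h
    have : Module.Finite R (kernel f' : ModuleCat R) :=
      Module.Finite.of_injective (kernel.ι f').hom
        ((ModuleCat.mono_iff_injective _).mp inferInstance)
    have := (tilde.functor R).preservesFiniteLimits_of_preservesHomology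
    obtain ⟨r⟩ := ih (kernel f') hK
    exact ⟨r.cons (hS.map_of_exact (tilde.functor R)) (isLocallyFreeOfFiniteRank_tilde F)⟩

end Affine

/-! ### Homological dimension read on affine charts -/

section Charts

variable {X : Scheme.{u}}

/-- Lift of an open immersion through another one with larger range. -/
lemma exists_openImmersion_lift {Y Z : Scheme.{u}} (j : Y ⟶ X) (k : Z ⟶ X) [IsOpenImmersion j]
    [IsOpenImmersion k] (h : Set.range k ⊆ Set.range j) :
    ∃ i : Z ⟶ Y, IsOpenImmersion i ∧ i ≫ j = k := by
  refine ⟨IsOpenImmersion.lift j k h, ?_, IsOpenImmersion.lift_fac _ _ _⟩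
  have : IsOpenImmersion (IsOpenImmersion.lift j k h ≫ j) := by
    rw [IsOpenImmersion.lift_fac]; infer_instance
  exact IsOpenImmersion.of_comp _ j

lemma homologicalDimensionLE_of_charts {E : X.Modules} {n : ℕ}
    (h : ∀ x : X, ∃ (R : CommRingCat.{u}) (j : Spec R ⟶ X) (_ : IsOpenImmersion j)
      (M : ModuleCat.{u} R), x ∈ Set.range j ∧ IsNoetherianRing R ∧ Module.Finite R M ∧
        HasProjectiveDimensionLE M n ∧ Nonempty (E.restrict j ≅ tilde M)) :
    HomologicalDimensionLE E n := by
  intro x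
  obtain ⟨R, j, _, M, hx, _, _, hM, ⟨e⟩⟩ := h x
  obtain ⟨r⟩ := nonempty_locallyFreeResolution_tilde n M hM
  obtain ⟨i, _, hi⟩ := exists_openImmersion_lift j j.opensRange.ι (by simp)
  exact ⟨j.opensRange, hx, ⟨((r.ofIso e.symm).restrict i).ofIso
    (restrictLiftIso E j j.opensRange.ι i hi).symm⟩⟩

/-- Only `E 0, …, E n` can be nonzero, so finitely many trivializing neighbourhoods have an open
intersection. Allowing every chart inside `W` leaves room to choose one adapted to `T`. -/
lemma HomologicalDimensionLE.exists_hasProjectiveDimensionLE {E : X.Modules} {n : ℕ}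
    (h : HomologicalDimensionLE E n) (x : X) :
    ∃ W : X.Opens, x ∈ W ∧ ∀ (R : CommRingCat.{u}) (j : Spec R ⟶ X) [IsOpenImmersion j]
      (M : ModuleCat.{u} R), Set.range j ⊆ W →
        Nonempty (E.restrict j ≅ (tilde.functor R).obj M) → HasProjectiveDimensionLE M n := by
  obtain ⟨U, hxU, ⟨r⟩⟩ := h x
  choose V hV I hI e using fun i ↦ r.locallyFree i ⟨x, hxU⟩
  let W : (U : Scheme.{u}).Opens := (Finset.range (n + 1)).inf V
  have hW : (⟨x, hxU⟩ : U) ∈ W := by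
    have (s : Finset ℕ) : (⟨x, hxU⟩ : U) ∈ s.inf V := by
      induction s using Finset.induction_on with
      | empty => trivial
      | insert a s _ ih => rw [Finset.inf_insert]; exact ⟨hV a, ih⟩
    exact this _
  refine ⟨U.ι ''ᵁ W, ⟨⟨x, hxU⟩, hW, rfl⟩, fun R j _ M hj ⟨f⟩ ↦ ?_⟩
  obtain ⟨k, _, hk⟩ := exists_openImmersion_lift U.ι j (by
    refine hj.trans ?_
    rintro _ ⟨y, -, rfl⟩
    exact ⟨y, rfl⟩)
  have hkW : Set.range k ⊆ W := by
    rintro _ ⟨y, rfl⟩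
    obtain ⟨z, hz, hzy⟩ := hj ⟨y, rfl⟩
    rw [← hk, Scheme.Hom.comp_apply] at hzy
    rwa [← U.ι.isOpenEmbedding.injective hzy]
  refine hasProjectiveDimensionLE_of_resolution
    ((r.restrict k).ofIso (restrictLiftIso E U.ι j k hk).symm) (fun i ↦ ?_) M f
  by_cases hi : n < i
  · exact ⟨PEmpty, inferInstance,
      ⟨((Functor.map_isZero (Scheme.Modules.restrictFunctor k) (r.isZero i hi))).iso
        (isZero_freeModule _ PEmpty)⟩⟩
  · have hle : W ≤ V i := Finset.inf_le (Finset.mem_range.mpr (by omega))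
    obtain ⟨l, _, hl⟩ := exists_openImmersion_lift (V i).ι k (by
      simpa using hkW.trans hle)
    exact ⟨I i, hI i, ⟨restrictLiftIso (r.E i) (V i).ι k l hl ≪≫
      (Scheme.Modules.restrictFunctor l).mapIso (e i).some ≪≫ restrictFreeIso l (I i)⟩⟩

end Charts

/-! ### Coherent modules on small affine charts -/

section Coherent

variable {X : Scheme.{u}}

lemma finite_of_epi_tilde {R : CommRingCat.{u}} {M : ModuleCat.{u} R} {I : Type u} [Finite I]
    (p : freeModule (Spec R) I ⟶ (tilde.functor R).obj M) (hp : Epi p) : Module.Finite R M := by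
  let t : (tilde.functor R).obj (ModuleCat.of R (I →₀ R)) ≅ freeModule (Spec R) I :=
    tildeFinsupp I
  let f := (tilde.functor R).preimage (t.hom ≫ p)
  have : Epi f := (tilde.functor R).epi_of_epi_map (by
    rw [(tilde.functor R).map_preimage]; infer_instance)
  exact Module.Finite.of_surjective f.hom ((ModuleCat.epi_iff_surjective _).mp this)

/-- Take `W` on which finitely many sections generate. On a chart inside `W`, quasi-coherence gives
a module, and the restricted generators give an epimorphism from a finite free sheaf, which descends
to modules. -/
lemma IsCoherent.exists_finite {E : X.Modules} (hE : IsCoherent E) (x : X) :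
    ∃ W : X.Opens, x ∈ W ∧ ∀ (R : CommRingCat.{u}) (j : Spec R ⟶ X) [IsOpenImmersion j],
      Set.range j ⊆ W →
      ∃ M : ModuleCat.{u} R, Module.Finite R M ∧
        Nonempty (E.restrict j ≅ (tilde.functor R).obj M) := by
  have := hE.isQuasicoherent
  obtain ⟨σ, hσ⟩ := hE.isFiniteType.exists_localGeneratorsData
  have hcov := σ.coversTop
  rw [Opens.coversTop_iff] at hcov
  obtain ⟨i, hi⟩ : ∃ i, x ∈ σ.X i := by
    have := TopologicalSpace.IsOpenCover.exists_mem hcov x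
    exact this
  let W : X.Opens := σ.X i
  refine ⟨W, hi, fun R j _ hj ↦ ?_⟩
  have hqc : SheafOfModules.IsQuasicoherent.{u} (E.restrict j) := inferInstance
  let M : ModuleCat R := moduleSpecΓFunctor.obj (E.restrict j)
  have := Scheme.Modules.isIso_fromTildeΓ_of_isQuasicoherent (R := R) (E.restrict j)
  let e : (tilde.functor R).obj M ≅ E.restrict j :=
    @asIso _ _ _ _ (Scheme.Modules.fromTildeΓ (R := R) (E.restrict j)) this
  refine ⟨M, ?_, ⟨e.symm⟩⟩
  obtain ⟨k, _, hk⟩ := exists_openImmersion_lift W.ι j (by simpa using hj)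
  let G := σ.generators i
  have := hσ.isFiniteType i
  have : PreservesColimitsOfSize.{u, u} (Scheme.Modules.restrictFunctor k) := inferInstance
  have : PreservesColimitsOfSize.{u, u} (Scheme.Modules.overEquiv W).functor := inferInstance
  let F : SheafOfModules.{u} (X.ringCatSheaf.over W) ⥤ (Spec R).Modules :=
    (Scheme.Modules.overEquiv W).functor ⋙ Scheme.Modules.restrictFunctor k
  have hF : PreservesColimitsOfSize.{u, u} F := comp_preservesColimits _ _
  let F' : SheafOfModules.{u} (X.ringCatSheaf.over W) ⥤
    SheafOfModules.{u} (Spec R).ringCatSheaf := F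
  have : PreservesColimitsOfSize.{u, u} F' := hF
  let G' := G.map F' (by exact (Scheme.Modules.restrictUnitIso k).symm)
  let iso : SheafOfModules.overFunctor X.ringCatSheaf W ⋙ F ≅
      Scheme.Modules.restrictFunctor j :=
    (Functor.associator _ _ _).symm ≪≫
      Functor.isoWhiskerRight (Scheme.Modules.overFunctorEquiv _) _ ≪≫
      (Scheme.Modules.restrictFunctorComp _ _).symm ≪≫ Scheme.Modules.restrictFunctorCongr hk
  let e' : F.obj ((SheafOfModules.overFunctor X.ringCatSheaf W).obj E) ≅ E.restrict j := iso.app E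
  let p : freeModule (Spec R) G.I ⟶ F.obj ((SheafOfModules.overFunctor X.ringCatSheaf W).obj E) :=
    G'.π
  have hp : Epi p := G'.epi
  have : Finite G.I := (hσ.isFiniteType i).finite
  exact finite_of_epi_tilde (p ≫ e'.hom ≫ e.inv) (epi_comp' hp inferInstance)

end Coherent

/-! ### Stalks and flatness over the base -/

/-- The stalk of an `𝒪_X`-module. -/
noncomputable abbrev modStalk {X : Scheme.{u}} (M : X.Modules) (x : X) : Type u :=
  ↑(TopCat.Presheaf.stalk M.presheaf x)

/-- The germ at `x` of a section of an `𝒪_X`-module. -/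
noncomputable def modGerm {X : Scheme.{u}} (M : X.Modules) {x : X} {U : X.Opens} (hx : x ∈ U)
    (m : Γ(M, U)) : modStalk M x :=
  M.presheaf.germ U x hx m

lemma modGerm_smul {X : Scheme.{u}} (M : X.Modules) {x : X} {U : X.Opens} (hx : x ∈ U)
    (r : Γ(X, U)) (m : Γ(M, U)) :
    modGerm M hx (r • m) = X.presheaf.germ U x hx r • modGerm M hx m :=
  PresheafOfModules.germ_smul (R := X.presheaf) M.val x U hx r m

lemma exists_modGerm_eq {X : Scheme.{u}} (M : X.Modules) {x : X} {V : X.Opens} (hV : x ∈ V)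
    (m : modStalk M x) :
    ∃ (U : X.Opens) (_ : U ≤ V) (hx : x ∈ U) (m' : Γ(M, U)), modGerm M hx m' = m := by
  obtain ⟨W, hW, m, rfl⟩ := TopCat.Presheaf.exists_germ_eq M.presheaf m
  exact ⟨W ⊓ V, inf_le_right, ⟨hW, hV⟩, M.presheaf.map (homOfLE inf_le_left).op m,
    TopCat.Presheaf.germ_res_apply M.presheaf (homOfLE inf_le_left) x ⟨hW, hV⟩ m⟩

/-- Restriction along an open immersion does not change the stalks. -/
noncomputable def modStalkRestrictEquiv {X Y : Scheme.{u}} (j : X ⟶ Y) [IsOpenImmersion j]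
    (M : Y.Modules) (x : X) : modStalk (M.restrict j) x ≃+ modStalk M (j x) :=
  ((Scheme.Modules.restrictStalkNatIso j x).app M).addCommGroupIsoToAddEquiv

lemma modStalkRestrictEquiv_modGerm {X Y : Scheme.{u}} (j : X ⟶ Y) [IsOpenImmersion j]
    (M : Y.Modules) {x : X} {U : X.Opens} (hx : x ∈ U) (m : Γ(M.restrict j, U)) :
    modStalkRestrictEquiv j M x (modGerm _ hx m) =
      modGerm M (U := j ''ᵁ U) (by simpa) ((M.restrictAppIso j U).hom m) :=
  congr($(Scheme.Modules.germ_restrictStalkNatIso_hom_app j x M hx) m)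

lemma modStalkRestrictEquiv_smul {X Y : Scheme.{u}} (j : X ⟶ Y) [IsOpenImmersion j]
    (M : Y.Modules) (x : X) (c : Y.presheaf.stalk (j x)) (m : modStalk (M.restrict j) x) :
    modStalkRestrictEquiv j M x (j.stalkMap x c • m) = c • modStalkRestrictEquiv j M x m := by
  obtain ⟨W, hW, c, rfl⟩ := TopCat.Presheaf.exists_germ_eq _ c
  obtain ⟨U, hU, hx, m, rfl⟩ := exists_modGerm_eq _ (V := j ⁻¹ᵁ W) hW m
  have hle : j ''ᵁ U ≤ W := by
    rintro _ ⟨y, hy, rfl⟩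
    exact hU hy
  have hc : j.stalkMap x (Y.presheaf.germ W (j x) hW c) = X.presheaf.germ U x hx
      (j.appLE W U hU c) := by
    rw [Scheme.Hom.germ_stalkMap_apply, Scheme.Hom.appLE, CommRingCat.comp_apply,
      TopCat.Presheaf.germ_res_apply]
  rw [hc, ← modGerm_smul, modStalkRestrictEquiv_modGerm, modStalkRestrictEquiv_modGerm,
    Scheme.Modules.smul_restrictAppIso_hom_apply]
  have hc' : (j.appIso U).inv (j.appLE W U hU c) = Y.presheaf.map (homOfLE hle).op c := by
    rw [← CommRingCat.comp_apply, Scheme.Hom.appLE_appIso_inv]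
  rw [hc', modGerm_smul]
  exact congrArg (fun t : Y.presheaf.stalk (j x) ↦ t • modGerm M _ _)
    (TopCat.Presheaf.germ_res_apply _ (homOfLE hle) (j x) _ c)

/-- The map induced on stalks by a morphism of `𝒪_X`-modules. -/
noncomputable def modStalkMap {X : Scheme.{u}} {M N : X.Modules} (e : M ⟶ N) (x : X) :
    modStalk M x →ₗ[X.presheaf.stalk x] modStalk N x where
  __ := ((TopCat.Presheaf.stalkFunctor _ x).map e.mapPresheaf).hom
  map_smul' c m := by
    obtain ⟨W, hW, c, rfl⟩ := TopCat.Presheaf.exists_germ_eq _ c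
    obtain ⟨U, hU, hx, m, rfl⟩ := exists_modGerm_eq _ (V := W) hW m
    rw [← TopCat.Presheaf.germ_res_apply _ (homOfLE hU) x hx c, ← modGerm_smul]
    have key (m : Γ(M, U)) : ((TopCat.Presheaf.stalkFunctor _ x).map e.mapPresheaf).hom
        (modGerm M hx m) = modGerm N hx (e.app U m) :=
      TopCat.Presheaf.stalkFunctor_map_germ_apply U x hx e.mapPresheaf m
    have key' (c : Γ(X, U)) (m : Γ(M, U)) : modGerm N hx (e.app U (c • m)) =
        X.presheaf.germ U x hx c • modGerm N hx (e.app U m) := by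
      rw [← modGerm_smul, Scheme.Modules.Hom.app_smul]
    exact (key _).trans ((key' _ m).trans
      (congrArg (fun t : modStalk N x ↦ X.presheaf.germ U x hx _ • t) (key m).symm))

lemma modStalkMap_comp {X : Scheme.{u}} {M N K : X.Modules} (e : M ⟶ N) (e' : N ⟶ K) (x : X)
    (m : modStalk M x) :
    modStalkMap (e ≫ e') x m = modStalkMap e' x (modStalkMap e x m) :=
  congr($((TopCat.Presheaf.stalkFunctor _ x).map_comp e.mapPresheaf e'.mapPresheaf) m)

lemma modStalkMap_id {X : Scheme.{u}} (M : X.Modules) (x : X) (m : modStalk M x) :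
    modStalkMap (𝟙 M) x m = m :=
  congr($((TopCat.Presheaf.stalkFunctor _ x).map_id M.presheaf) m)

/-- The isomorphism induced on stalks by an isomorphism of `𝒪_X`-modules. -/
noncomputable def modStalkEquiv {X : Scheme.{u}} {M N : X.Modules} (e : M ≅ N) (x : X) :
    modStalk M x ≃ₗ[X.presheaf.stalk x] modStalk N x where
  __ := modStalkMap e.hom x
  invFun := modStalkMap e.inv x
  left_inv m := by
    refine (modStalkMap_comp e.hom e.inv x m).symm.trans ?_
    rw [e.hom_inv_id, modStalkMap_id]
  right_inv m := by
    refine (modStalkMap_comp e.inv e.hom x m).symm.trans ?_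
    rw [e.inv_hom_id, modStalkMap_id]

lemma IsFlatOver.of_iso {X T : Scheme.{u}} {f : X ⟶ T} {M N : X.Modules} (h : IsFlatOver f M)
    (e : M ≅ N) : IsFlatOver f N := by
  intro x
  let : Module (T.presheaf.stalk (f x)) (modStalk M x) := Module.compHom _ (f.stalkMap x).hom
  let : Module (T.presheaf.stalk (f x)) (modStalk N x) := Module.compHom _ (f.stalkMap x).hom
  have := h x
  exact Module.Flat.of_linearEquiv (M := modStalk M x) (N := modStalk N x)
    { (modStalkEquiv e x).symm with
      map_smul' r m := (modStalkEquiv e x).symm.map_smul (f.stalkMap x r) m }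

lemma IsFlatOver.restrict {X Y T : Scheme.{u}} {f : X ⟶ T} {M : X.Modules} (h : IsFlatOver f M)
    (j : Y ⟶ X) [IsOpenImmersion j] : IsFlatOver (j ≫ f) (M.restrict j) := by
  intro x
  let : Module (T.presheaf.stalk (f (j x))) (modStalk M (j x)) :=
    Module.compHom _ (f.stalkMap (j x)).hom
  let : Module (T.presheaf.stalk (f (j x))) (modStalk (M.restrict j) x) :=
    Module.compHom _ ((j ≫ f).stalkMap x).hom
  have := h (j x)
  refine Module.Flat.of_linearEquiv (R := T.presheaf.stalk (f (j x))) (M := modStalk M (j x))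
    (N := modStalk (M.restrict j) x) { modStalkRestrictEquiv j M x with map_smul' r m := ?_ }
  refine Eq.trans ?_ (modStalkRestrictEquiv_smul j M x (f.stalkMap (j x) r) m)
  exact congrArg (fun t : Y.presheaf.stalk x ↦ modStalkRestrictEquiv j M x (t • m))
    congr($(Scheme.Hom.stalkMap_comp j f x) r)

/-- Flatness over `A` can be tested at the maximal ideals of `B`. Any model `N` of the localization
is allowed, so sheaf stalks can be used. -/
lemma flat_of_forall_isMaximal {A B M : Type u} [CommRing A] [CommRing B] [Algebra A B]
    [AddCommGroup M] [Module A M] [Module B M] [IsScalarTower A B M]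
    (H : ∀ (P : Ideal B) [P.IsMaximal], ∃ (N : Type u) (_ : AddCommGroup N) (_ : Module A N)
      (_ : Module B N) (_ : IsScalarTower A B N) (f : M →ₗ[B] N),
      IsLocalizedModule.AtPrime P f ∧ Module.Flat A N) : Module.Flat A M := by
  refine Module.flat_of_isLocalized_maximal (R := A) B M (fun P _ ↦ LocalizedModule P.primeCompl M)
    (fun P _ ↦ LocalizedModule.mkLinearMap _ _) fun P _ ↦ ?_
  obtain ⟨N, _, _, _, _, f, _, _⟩ := H P
  exact Module.Flat.of_linearEquiv ((IsLocalizedModule.iso P.primeCompl f).restrictScalars A)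

lemma flat_toStalk (A : CommRingCat.{u}) (q : PrimeSpectrum A) :
    (StructureSheaf.toStalk A q).hom.Flat :=
  IsLocalization.flat ((Spec.structureSheaf A).presheaf.stalk q) q.asIdeal.primeCompl

/-- The action of `B` on the stalks of the module associated with a `B`-module. -/
noncomputable abbrev modStalkTildeModule {B : CommRingCat.{u}} (M : ModuleCat.{u} B)
    (x : Spec B) : Module B (modStalk (tilde M) x) :=
  tilde.instModuleCarrierCarrierStalkAbPresheaf M x

lemma exists_isLocalizedModule_modStalk_tilde {B : CommRingCat.{u}} (M : ModuleCat.{u} B)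
    (P : Ideal B) [P.IsPrime] (x : Spec B) (hx : x = (⟨P, inferInstance⟩ : PrimeSpectrum B)) :
    let := modStalkTildeModule M x
    ∃ f : M →ₗ[B] modStalk (tilde M) x, IsLocalizedModule.AtPrime P f := by
  subst hx
  exact ⟨(tilde.toStalk M _).hom,
    tilde.instIsLocalizedModuleCarrierCarrierOfCarrierStalkAbPresheafPrimeComplAsIdealHomToStalk M
      (⟨P, inferInstance⟩ : PrimeSpectrum B)⟩

lemma flat_of_isFlatOver_tilde {T : Scheme.{u}} {A B : CommRingCat.{u}} [Algebra A B] (φ : A ⟶ B)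
    (hφ : algebraMap A B = φ.hom)
    (i : Spec A ⟶ T) [IsOpenImmersion i] (M : ModuleCat.{u} B) [Module A M] [IsScalarTower A B M]
    (h : IsFlatOver (Spec.map φ ≫ i) ((tilde.functor B).obj M)) : Module.Flat A M := by
  refine flat_of_forall_isMaximal (B := B) fun P _ ↦ ?_
  obtain ⟨x, hx⟩ : ∃ x : Spec B, x = (⟨P, inferInstance⟩ : PrimeSpectrum B) := ⟨_, rfl⟩
  let := modStalkTildeModule M x
  let : Module A (modStalk (tilde M) x) := Module.compHom _ φ.hom
  obtain ⟨f, hf⟩ := exists_isLocalizedModule_modStalk_tilde M P x hx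
  refine ⟨modStalk (tilde M) x, inferInstance, inferInstance, inferInstance,
    .of_algebraMap_smul fun r m ↦ by rw [hφ]; rfl, f, hf, ?_⟩
  let q : Spec A := Spec.map φ x
  have : IsIso (i.stalkMap q) := inferInstance
  let τ : A ⟶ (Spec A).presheaf.stalk q := StructureSheaf.toStalk A q
  -- Localization at `q` followed by the inverse of the stalk isomorphism of the open immersion `i`.
  -- It is flat, so flatness over the stalk of `T` gives flatness over `A`.
  let ψ : A ⟶ T.presheaf.stalk (i q) := τ ≫ inv (i.stalkMap q)
  let : Algebra A (T.presheaf.stalk (i q)) := ψ.hom.toAlgebra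
  let : Module (T.presheaf.stalk (i q)) (modStalk (tilde M) x) :=
    Module.compHom _ ((Spec.map φ ≫ i).stalkMap x).hom
  have : Module.Flat (T.presheaf.stalk (i q)) (modStalk (tilde M) x) := h x
  have : Module.Flat A (T.presheaf.stalk (i q)) :=
    (flat_toStalk A q).comp (.of_bijective (ConcreteCategory.bijective_of_isIso (inv (i.stalkMap q))))
  have : IsScalarTower A (T.presheaf.stalk (i q)) (modStalk (tilde M) x) := by
    refine .of_algebraMap_smul fun r m ↦ ?_
    have : (Spec.map φ ≫ i).stalkMap x (ψ r) = StructureSheaf.toStalk B x (φ r) := by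
      rw [Scheme.Hom.stalkMap_comp, CommRingCat.comp_apply]
      have : i.stalkMap q (ψ r) = StructureSheaf.toStalk A q r := by
        simp only [ψ, CommRingCat.comp_apply]
        rw [← CommRingCat.comp_apply, IsIso.inv_hom_id]
        rfl
      refine congr((Spec.map φ).stalkMap x $this).trans ?_
      exact AlgebraicGeometry.stalkMap_toStalk_apply φ x r
    exact congrArg (fun t : (Spec B).presheaf.stalk x ↦ t • m) this
  exact .trans A (T.presheaf.stalk (i q)) _

/-! ### Comparing charts of `X` and `X_red` -/

/-- Restriction to a chart is itself a pullback, so the commutative square moves the computation to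
`Spec B' ⟶ Spec B`, where pullback is base change of modules. -/
lemma nonempty_pullback_restrict_iso {X Y : Scheme.{u}} (p : Y ⟶ X) {B B' : CommRingCat.{u}}
    (j : Spec B ⟶ X) [IsOpenImmersion j] (j' : Spec B' ⟶ Y) [IsOpenImmersion j'] (φ : B ⟶ B')
    [Algebra B B'] (hφ : algebraMap B B' = φ.hom) (h : Spec.map φ ≫ j = j' ≫ p)
    (E : X.Modules) (M : ModuleCat.{u} B) (e : E.restrict j ≅ (tilde.functor B).obj M) :
    Nonempty (((Scheme.Modules.pullback p).obj E).restrict j' ≅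
      (tilde.functor B').obj (ModuleCat.of B' (TensorProduct B B' M))) := by
  obtain ⟨t⟩ := nonempty_extendScalars_iso φ.hom hφ M
  exact ⟨(Scheme.Modules.restrictFunctorIsoPullback j').app _ ≪≫
    (Scheme.Modules.pullbackComp j' p).app E ≪≫
    (Scheme.Modules.pullbackCongr h.symm).app E ≪≫
    ((Scheme.Modules.pullbackComp (Spec.map φ) j).app E).symm ≪≫
    (Scheme.Modules.pullback (Spec.map φ)).mapIso
      (((Scheme.Modules.restrictFunctorIsoPullback j).app E).symm ≪≫ e) ≪≫
    (tildeCompPullback φ).app M ≪≫ (tilde.functor B').mapIso t⟩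

lemma redι_app_surjective (T : Scheme.{u}) {V : T.Opens} (hV : IsAffineOpen V) :
    Function.Surjective ((redι T).app V) :=
  T.nilradical.subschemeι_app_surjective ⟨V, hV⟩

lemma isNilpotent_ker_redι_app (T : Scheme.{u}) [IsLocallyNoetherian T] {V : T.Opens}
    (hV : IsAffineOpen V) : IsNilpotent (RingHom.ker ((redι T).app V).hom) := by
  have : IsNoetherianRing Γ(T, V) := IsLocallyNoetherian.component_noetherian ⟨V, hV⟩
  have h : RingHom.ker ((redι T).app V).hom = nilradical Γ(T, V) := 
    (T.nilradical.ker_subschemeι_app ⟨V, hV⟩).trans (by simp [Scheme.nilradical, nilradical])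
  rw [h]
  exact IsNoetherianRing.isNilpotent_nilradical _

/-- On affine charts, `E_red` is given by a module of the same projective dimension as that of `E`. -/
lemma exists_baseRed_chart {X T : Scheme.{u}} [IsLocallyNoetherian T] (f : X ⟶ T) [Flat f]
    {E : X.Modules} (hE : IsFlatOver f E) {V : T.Opens} (hV : IsAffineOpen V) {U : X.Opens}
    (hU : IsAffineOpen U) (hUV : U ≤ f ⁻¹ᵁ V) (M : ModuleCat.{u} Γ(X, U))
    (e : E.restrict hU.fromSpec ≅ (tilde.functor _).obj M) :
    let hU' := hU.preimage (pullback.fst f (redι T))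
    ∃ M' : ModuleCat.{u} Γ(baseRed f, pullback.fst f (redι T) ⁻¹ᵁ U),
      Nonempty ((moduleRed f E).restrict hU'.fromSpec ≅ (tilde.functor _).obj M') ∧
      (Module.Finite Γ(X, U) M → Module.Finite Γ(baseRed f, pullback.fst f (redι T) ⁻¹ᵁ U) M') ∧
      ∀ n, HasProjectiveDimensionLE M' n ↔ HasProjectiveDimensionLE M n := by
  intro hU'
  let p := pullback.fst f (redι T)
  let q := pullback.snd f (redι T)
  have hq : p ⁻¹ᵁ U ≤ q ⁻¹ᵁ (redι T) ⁻¹ᵁ V := by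
    rw [← Scheme.Hom.comp_preimage, ← pullback.condition, Scheme.Hom.comp_preimage]
    exact p.preimage_mono hUV
  -- On affine opens the fibre product gives a pushout of section rings, which supplies `B' = A' ⊗
  -- B`.
  have hpo := (isIso_pushoutSection_iff (IsPullback.of_hasPullback f (redι T)) (US := V)
    (UX := U) (UT := redι T ⁻¹ᵁ V) (UY := p ⁻¹ᵁ U) le_rfl hUV (inf_eq_left.mpr hq).symm).mp
    (isIso_pushoutSection_of_isAffineOpen _ _ _ _ hV (hV.preimage _) hU)
  let φA := (redι T).appLE V (redι T ⁻¹ᵁ V) le_rfl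
  let φB := f.appLE V U hUV
  let φ := p.appLE U (p ⁻¹ᵁ U) le_rfl
  let ψ := q.appLE (redι T ⁻¹ᵁ V) (p ⁻¹ᵁ U) hq
  let : Algebra Γ(T, V) Γ(T.nilradical.subscheme, redι T ⁻¹ᵁ V) := φA.hom.toAlgebra
  let : Algebra Γ(T, V) Γ(X, U) := φB.hom.toAlgebra
  let : Algebra Γ(X, U) Γ(baseRed f, p ⁻¹ᵁ U) := φ.hom.toAlgebra
  let : Algebra Γ(T.nilradical.subscheme, redι T ⁻¹ᵁ V) Γ(baseRed f, p ⁻¹ᵁ U) := ψ.hom.toAlgebra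
  let : Algebra Γ(T, V) Γ(baseRed f, p ⁻¹ᵁ U) := (φB ≫ φ).hom.toAlgebra
  have : IsScalarTower Γ(T, V) Γ(X, U) Γ(baseRed f, p ⁻¹ᵁ U) := .of_algebraMap_eq fun _ ↦ rfl
  have : IsScalarTower Γ(T, V) Γ(T.nilradical.subscheme, redι T ⁻¹ᵁ V) Γ(baseRed f, p ⁻¹ᵁ U) :=
    .of_algebraMap_eq fun r ↦ congr($(hpo.w) r)
  have : Algebra.IsPushout Γ(T, V) Γ(T.nilradical.subscheme, redι T ⁻¹ᵁ V) Γ(X, U)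
      Γ(baseRed f, p ⁻¹ᵁ U) := CommRingCat.isPushout_iff_isPushout.mp hpo.flip
  have : Module.Flat Γ(T, V) Γ(X, U) := f.flat_appLE hV hU hUV
  let : Module Γ(T, V) M := Module.compHom M φB.hom
  have : IsScalarTower Γ(T, V) Γ(X, U) M := .of_algebraMap_smul fun _ _ ↦ rfl
  have : Module.Flat Γ(T, V) M := by
    refine flat_of_isFlatOver_tilde φB rfl hV.fromSpec M ?_
    rw [IsAffineOpen.SpecMap_appLE_fromSpec f hV hU hUV]
    exact (hE.restrict hU.fromSpec).of_iso e
  have hφA : φA = (redι T).app V := ((redι T).app_eq_appLE).symm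
  refine ⟨ModuleCat.of _ (TensorProduct Γ(X, U) Γ(baseRed f, p ⁻¹ᵁ U) M),
    nonempty_pullback_restrict_iso p hU.fromSpec hU'.fromSpec φ rfl
      (IsAffineOpen.SpecMap_appLE_fromSpec p hU hU' le_rfl) E M e,
    fun _ ↦ inferInstanceAs (Module.Finite _ (TensorProduct Γ(X, U) Γ(baseRed f, p ⁻¹ᵁ U) M)),
    fun n ↦ ?_⟩
  refine hasProjectiveDimensionLE_baseChange_iff (A := Γ(T, V))
    (A' := Γ(T.nilradical.subscheme, redι T ⁻¹ᵁ V)) ?_ ?_ M n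
  · change Function.Surjective φA
    rw [hφA]
    exact redι_app_surjective T hV
  · change IsNilpotent (RingHom.ker φA.hom)
    rw [hφA]
    exact isNilpotent_ker_redι_app T hV

/-- The projection `X ×_T T_red ⟶ X` is a homeomorphism on underlying spaces. -/
lemma isHomeomorph_fst_redι {X T : Scheme.{u}} (f : X ⟶ T) :
    IsHomeomorph (pullback.fst f (redι T)) := by
  have : Surjective (redι T) := ⟨Set.range_eq_univ.mp (by
    rw [Scheme.IdealSheafData.range_subschemeι, Scheme.support_nilradical]; rfl)⟩
  rw [isHomeomorph_iff_isEmbedding_surjective]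
  exact ⟨(pullback.fst f (redι T)).isEmbedding, (pullback.fst f (redι T)).surjective⟩

/-- Homological dimension over a flat `T`-scheme is unchanged by base change to `T_red`. -/
theorem homologicalDimensionLE_iff_moduleRed {X T : Scheme.{u}} [IsLocallyNoetherian X]
    [IsLocallyNoetherian T] (f : X ⟶ T) [Flat f] (E : X.Modules) (hE : IsCoherent E)
    (hflat : IsFlatOver f E) (n : ℕ) :
    HomologicalDimensionLE E n ↔ HomologicalDimensionLE (moduleRed f E) n := by
  let p := pullback.fst f (redι T)
  have hp : IsHomeomorph p := isHomeomorph_fst_redι f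
  have key (x : X) (W₀ : X.Opens) (hx : x ∈ W₀) : ∃ (U : X.Opens) (hU : IsAffineOpen U)
      (M : ModuleCat.{u} Γ(X, U)) (M' : ModuleCat.{u} Γ(baseRed f, p ⁻¹ᵁ U)),
      x ∈ U ∧ U ≤ W₀ ∧ Module.Finite Γ(X, U) M ∧ Module.Finite Γ(baseRed f, p ⁻¹ᵁ U) M' ∧
      Nonempty (E.restrict hU.fromSpec ≅ (tilde.functor _).obj M) ∧
      Nonempty ((moduleRed f E).restrict (hU.preimage p).fromSpec ≅ (tilde.functor _).obj M') ∧
      (HasProjectiveDimensionLE M' n ↔ HasProjectiveDimensionLE M n) := by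
    obtain ⟨W₁, hx₁, H⟩ := hE.exists_finite x
    obtain ⟨V, hV, hxV, -⟩ := exists_isAffineOpen_mem_and_subset (U := ⊤) (x := f x) trivial
    obtain ⟨U, hU, hxU, hUW⟩ := exists_isAffineOpen_mem_and_subset (x := x)
      (U := W₀ ⊓ W₁ ⊓ f ⁻¹ᵁ V) ⟨⟨hx, hx₁⟩, hxV⟩
    obtain ⟨M, hM, ⟨e⟩⟩ := H _ hU.fromSpec (by
      rw [hU.range_fromSpec]; exact fun y hy ↦ (hUW hy).1.2)
    obtain ⟨M', he', hM', hpd⟩ := exists_baseRed_chart f hflat hV hU (fun y hy ↦ (hUW hy).2) M e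
    exact ⟨U, hU, M, M', hxU, fun y hy ↦ (hUW hy).1.1, hM, hM' hM, ⟨e⟩, he', hpd n⟩
  constructor
  · intro h
    refine homologicalDimensionLE_of_charts fun y ↦ ?_
    obtain ⟨W, hW, H⟩ := h.exists_hasProjectiveDimensionLE (p y)
    obtain ⟨U, hU, M, M', hxU, hUW, hM, hM', he, he', hpd⟩ := key (p y) W hW
    refine ⟨_, (hU.preimage p).fromSpec, inferInstance, M', ?_,
      IsLocallyNoetherian.component_noetherian ⟨_, hU.preimage p⟩, hM',
      hpd.mpr (H _ hU.fromSpec M ?_ he), he'⟩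
    · rw [(hU.preimage p).range_fromSpec]
      exact hxU
    · rw [hU.range_fromSpec]
      exact hUW
  · intro h
    refine homologicalDimensionLE_of_charts fun x ↦ ?_
    obtain ⟨y, rfl⟩ := hp.surjective x
    obtain ⟨W, hW, H⟩ := h.exists_hasProjectiveDimensionLE y
    -- A neighbourhood in `X_red` is transported to `X` by the homeomorphism `p`; injectivity of `p`
    -- then puts the preimage of any `U ≤ W₀` back inside `W`.
    let W₀ : X.Opens := ⟨p '' W, hp.isOpenMap _ W.2⟩
    obtain ⟨U, hU, M, M', hxU, hUW, hM, hM', he, he', hpd⟩ := key (p y) W₀ ⟨y, hW, rfl⟩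
    refine ⟨_, hU.fromSpec, inferInstance, M, ?_,
      IsLocallyNoetherian.component_noetherian ⟨_, hU⟩, hM,
      hpd.mp (H _ (hU.preimage p).fromSpec M' ?_ he'), he⟩
    · rw [hU.range_fromSpec]
      exact hxU
    · rw [(hU.preimage p).range_fromSpec]
      intro z hz
      obtain ⟨w, hw, hwz⟩ := hUW hz
      exact hp.injective hwz ▸ hw

end SheafHomDim

theorem theorem2 {X T : AlgebraicGeometry.Scheme.{u}}
    [AlgebraicGeometry.IsNoetherian X] [AlgebraicGeometry.IsNoetherian T]
    (f : X ⟶ T) [AlgebraicGeometry.Flat f]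
    (E : X.Modules) (hE : SheafHomDim.IsCoherent E) (hflat : SheafHomDim.IsFlatOver f E) (n : ℕ) :
    SheafHomDim.HomologicalDimensionLE E n ↔
      SheafHomDim.HomologicalDimensionLE (SheafHomDim.moduleRed f E) n :=
  SheafHomDim.homologicalDimensionLE_iff_moduleRed f E hE hflat n
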